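/- Let $D\ge 1$, $\alpha_1,\dots,\alpha_{D+1}>0$, $\lambda_1,\dots,\lambda_{D+1}\ge 0$, and put $\alpha^+=\sum_i\alpha_i$, $\lambda^+=\sum_i\lambda_i$. Let $\mathcal S^D=\{x\in\mathbb R^D:\ 0<x_i<1,\ \sum_{i=1}^D x_i<1\}$, and for $x\in\mathcal S^D$ write $x_{D+1}=1-\sum_{i=1}^D x_i$. For $a\in(0,\infty)^{D+1}$ with sum $a^+$ let $$\mathrm{Dir}^D(x;a)=\frac{\Gamma(a^+)}{\prod_{i=1}^{D+1}\Gamma(a_i)}\prod_{i=1}^{D+1}x_i^{a_i-1},\qquad {}_0F_1(b;z)=\sum_{k\ge 0}\frac{z^k}{(b)_k\,k!},$$ where $(b)_k=b(b+1)\cdots(b+k-1)$. The non-central chi-squared law $\chi'^2_g(\lambda)$, $g>0$, $\lambda\ge0$, is the law of $Y'$ when $M\sim\mathrm{Poisson}(\lambda/2)$ and $Y'\mid M\sim\chi^2_{g+2M}$. The conditional law of a random element $X$ given $T=t$, for a point $t$ in the support of the law of a real random variable $T$, means the value at $t$ of a regular conditional distribution of $X$ given $T$ that is weakly continuous at $t$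 (this value is unique when such a version exists). Let $Y'_1,\dots,Y'_{D+1}$ be independent with $Y'_i\sim\chi'^2_{2\alpha_i}(\lambda_i)$, and $Y'^+=\sum_i Y'_i$. Let $\mathrm{CNcDir}^D(\alpha,\lambda)$ be the conditional law of $(Y'_1/Y'^+,\dots,Y'_D/Y'^+)$ given $Y'^+=1$. Let $\mathrm{MW}^{D+1}(\alpha^+,\lambda)$ be the conditional law of $M=(M_1,\dots,M_{D+1})$ given $Y'^+=1$, when the pairs $(M_i,Y'_i)$ are independent, $M_i\sim\mathrm{Poisson}(\lambda_i/2)$ and $Y'_i\mid M_i\sim\chi^2_{2\alpha_i+2M_i}$. Then both conditional laws exist and are unique. If $N\sim\mathrm{MW}^{D+1}(\alpha^+,\lambda)$ then, for $j\in\mathbb N_0^{D+1}$ with $j^+=\sum_i j_i$, $$\Pr(N=j)=\frac{1}{{}_0F_1(\alpha^+;\lambda^+/4)}\,\frac{1}{(\alpha^+)_{j^+}}\prod_{i=1}^{D+1}\frac{(\lambda_i/4)^{j_i}}{j_i!}.$$ The law $\mathrm{CNcDir}^D(\alpha,\lambda)$ is concentrated on $\mathcal S^D$ and has there, with respect to Lebesgue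 measure, the density $$\mathrm{CNcDir}^D(x;\alpha,\lambda)=\sum_{j\in\mathbb N_0^{D+1}}\Pr(N=j)\,\mathrm{Dir}^D(x;\alpha+j),$$ where the series converges for every $x\in\mathcal S^D$, and, equivalently, for every $x\in\mathcal S^D$, $$\mathrm{CNcDir}^D(x;\alpha,\lambda)=\mathrm{Dir}^D(x;\alpha)\cdot\frac{\prod_{i=1}^{D+1}{}_0F_1\!\left(\alpha_i;\tfrac{\lambda_i}{4}x_i\right)}{{}_0F_1\!\left(\alpha^+;\tfrac{\lambda^+}{4}\right)}.$$ -/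

import Mathlib

open MeasureTheory ProbabilityTheory Filter Topology
open scoped ENNReal NNReal BoundedContinuousFunction

namespace CondNcDir

noncomputable section

/-- The hypergeometric function `₀F₁(b; x) = ∑ₖ xᵏ / ((b)ₖ k!)`, where `(b)ₖ` is the ascending
factorial. -/
def hyp0F1 (b x : ℝ) : ℝ :=
  ∑' k : ℕ, 1 / (ascPochhammer ℝ k).eval b * (x ^ k / (k.factorial : ℝ))

/-- The central chi-squared law with `g > 0` degrees of freedom: the gamma law with shape `g / 2`
and rate `1 / 2`. -/
def chiSquared (g : ℝ) : Measure ℝ :=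
  gammaMeasure (g / 2) (1 / 2)

/-- The joint law of `(M, Y')` where `M ∼ Poisson(l / 2)` and `Y'` given `M = m` is chi-squared
with `g + 2 m` degrees of freedom. -/
def poissonChiSquared (g l : ℝ) : Measure (ℕ × ℝ) :=
  Measure.sum fun m : ℕ =>
    poissonMeasure (l / 2).toNNReal {m} • (Measure.dirac m).prod (chiSquared (g + 2 * m))

/-- The non-central chi-squared law with `g > 0` degrees of freedom and non-centrality parameter
`l ≥ 0`: the `Poisson(l / 2)` mixture of the chi-squared laws with `g + 2 m` degrees of freedom. -/
def noncentralChiSquared (g l : ℝ) : Measure ℝ :=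
  Measure.sum fun m : ℕ => poissonMeasure (l / 2).toNNReal {m} • chiSquared (g + 2 * m)

/-- `ν` is the conditional law of `X` given `T = t`, where `t` may have probability zero: `t` lies
in the support of the law of `T`, and `ν` is the value at `t` of a regular conditional distribution
`κ` of `X` given `T` which is continuous at `t` for weak convergence. Two versions `κ` agree almost
everywhere for the law of `T`, so by continuity they agree at the support point `t`. -/
def IsCondLawAt {Ω E : Type*} [MeasurableSpace Ω] [TopologicalSpace E] [MeasurableSpace E]
    (P : Measure Ω) (X : Ω → E) (T : Ω → ℝ) (t : ℝ) (ν : Measure E) : Prop :=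
  (∀ U ∈ 𝓝 t, 0 < P.map T U) ∧
  ∃ κ : Kernel ℝ E, IsMarkovKernel κ ∧
    P.map (fun ω => (T ω, X ω)) = (P.map T).compProd κ ∧
    (∀ f : E →ᵇ ℝ, ContinuousAt (fun s => ∫ x, f x ∂(κ s)) t) ∧
    κ t = ν

/-- The open unit simplex of `ℝᴰ`. -/
def simplex (D : ℕ) : Set (Fin D → ℝ) :=
  {x | (∀ i, 0 < x i ∧ x i < 1) ∧ ∑ i, x i < 1}

/-- The vector `(x₁, …, x_D, 1 - ∑ xᵢ)`. -/
def complete {D : ℕ} (x : Fin D → ℝ) : Fin (D + 1) → ℝ :=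
  Fin.snoc (α := fun _ => ℝ) x (1 - ∑ i, x i)

/-- The vector `(y₁ / y⁺, …, y_D / y⁺)` where `y⁺ = y₁ + ⋯ + y_{D+1}`. -/
def normalized {D : ℕ} (y : Fin (D + 1) → ℝ) : Fin D → ℝ :=
  fun i => y i.castSucc / ∑ k, y k

/-- The Dirichlet density with shape parameters `a`, on the open unit simplex. -/
def dirichletDensity {D : ℕ} (a : Fin (D + 1) → ℝ) (x : Fin D → ℝ) : ℝ :=
  Real.Gamma (∑ i, a i) / (∏ i, Real.Gamma (a i)) * ∏ i, complete x i ^ (a i - 1)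

/-- The mixture of the Dirichlet densities with shape parameters `α + j`, weighted by the
probabilities `w {j}` of a law `w` on the multi-indices `j`. -/
def mixtureDensity {D : ℕ} (w : Measure (Fin (D + 1) → ℕ)) (α : Fin (D + 1) → ℝ)
    (x : Fin D → ℝ) : ℝ :=
  ∑' j : Fin (D + 1) → ℕ, w.real {j} * dirichletDensity (fun i => α i + j i) x

/-- The perturbed Dirichlet density
`Dir(x; α) · ∏ᵢ ₀F₁(αᵢ; λᵢ xᵢ / 4) / ₀F₁(α⁺; λ⁺ / 4)`. -/
def perturbedDensity {D : ℕ} (α lam : Fin (D + 1) → ℝ) (x : Fin D → ℝ) : ℝ :=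
  dirichletDensity α x *
    ((∏ i, hyp0F1 (α i) (lam i / 4 * complete x i)) / hyp0F1 (∑ i, α i) ((∑ i, lam i) / 4))

end

end CondNcDir

/-! Given `M = j`, the variables `Z i` are independent gamma variables with shapes `α i + j i` and
common rate `1 / 2`. Their sum is therefore independent of the normalized vector, which has the
Dirichlet law with parameters `α + j` (`setLIntegral_orthant_gammaPDF`). Only the law of `M` is
affected by the value `s` of the sum. By Bayes, the weight of `j` given `s` is proportional to the
Poisson weights times the gamma density of shape `α⁺ + j⁺` at `s`. After removal of factors free of
`j` this is `∏ (s λᵢ / 4) ^ jᵢ / jᵢ!` over `(α⁺)_{j⁺}`, and the multinomial theorem sums it to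
`₀F₁(α⁺; s λ⁺ / 4)` (`prod_poisson_mul_gammaPDFReal`, `hasSum_multiTerm`). Hence the joint law of
sum, `M` and normalized vector disintegrates explicitly (`lintegral_jointLaw_normalized`). The
weights vary continuously with `s`, so the resulting kernels are weakly continuous and their values
at `s = 1` are the conditional laws; continuity and positive mass near `1` give uniqueness
(`IsCondLawAt.unique`). Writing `max s 0` for `s` makes the kernels Markov and continuous on all of
`ℝ`; the law of the sum only charges `s > 0`. For the density, the factor `(α⁺)_{j⁺}` in `Dir(x; α +
j) / Dir(x; α)` cancels the one in the weight, and the remaining multi-series is a product of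
one-variable `₀F₁` series (`hasSum_mixtureDensity`). -/

namespace CondNcDir

noncomputable section

/-! ### Products of measures and of series -/

lemma lintegral_pi_prod {X : Type*} [MeasurableSpace X] {n : ℕ} (μ : Fin n → Measure X)
    [∀ i, SigmaFinite (μ i)] {f : Fin n → X → ℝ≥0∞} (hf : ∀ i, Measurable (f i)) :
    ∫⁻ x, ∏ i, f i (x i) ∂(Measure.pi μ) = ∏ i, ∫⁻ x, f i x ∂(μ i) := by
  induction n with
  | zero => simp
  | succ n ih =>
    rw [← (measurePreserving_piFinSuccAbove μ 0).symm.map_eq, lintegral_map_equiv]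
    simp_rw [MeasurableEquiv.piFinSuccAbove_symm_apply, Fin.insertNthEquiv,
      Fin.prod_univ_succ]
    simp only [Fin.zero_succAbove, Equiv.coe_fn_mk, Fin.insertNth_zero, Fin.cons_zero,
      Fin.cons_succ, cast_eq]
    rw [lintegral_prod_mul (f := f 0)
      (g := fun y : Fin n → X => ∏ i, f i.succ (y i)) (hf 0).aemeasurable
      (Finset.measurable_prod _ fun i _ => (hf i.succ).comp (measurable_pi_apply i)).aemeasurable,
      ih (fun i => μ i.succ) (fun i => hf i.succ)]

lemma pi_withDensity {X : Type*} [MeasurableSpace X] {n : ℕ} (μ : Fin n → Measure X)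
    [∀ i, SigmaFinite (μ i)] {f : Fin n → X → ℝ≥0∞} (hf : ∀ i, Measurable (f i))
    [∀ i, SigmaFinite ((μ i).withDensity (f i))] :
    Measure.pi (fun i => (μ i).withDensity (f i)) =
      (Measure.pi μ).withDensity fun x => ∏ i, f i (x i) := by
  refine Measure.pi_eq fun s hs => ?_
  rw [withDensity_apply _ (MeasurableSet.univ_pi hs), Measure.restrict_pi_pi,
    lintegral_pi_prod _ hf]
  exact Finset.prod_congr rfl fun i _ => (withDensity_apply _ (hs i)).symm

lemma pi_count (n : ℕ) :
    Measure.pi (fun _ : Fin n => (Measure.count : Measure ℕ)) = Measure.count := by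
  refine Measure.ext_of_singleton fun j => ?_
  rw [Measure.pi_singleton]
  simp

/-- A series over multi-indices is an integral against a product of counting measures, so Tonelli
factors it. -/
lemma tsum_pi_prod {n : ℕ} (f : Fin n → ℕ → ℝ≥0∞) :
    ∑' j : Fin n → ℕ, ∏ i, f i (j i) = ∏ i, ∑' k, f i k := by
  rw [← lintegral_count, ← pi_count, lintegral_pi_prod _ fun i => measurable_of_countable _]
  simp_rw [lintegral_count]

lemma hasSum_of_tsum_ofReal {ι : Type*} {f : ι → ℝ} {c : ℝ} (hf : ∀ i, 0 ≤ f i) (hc : 0 ≤ c)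
    (h : ∑' i, ENNReal.ofReal (f i) = ENNReal.ofReal c) : HasSum f c := by
  have hs : Summable f := by
    refine (ENNReal.summable_toReal (f := fun i => ENNReal.ofReal (f i))
      (by rw [h]; exact ENNReal.ofReal_ne_top)).congr fun i => ?_
    exact ENNReal.toReal_ofReal (hf i)
  rw [← ENNReal.ofReal_tsum_of_nonneg hf hs,
    ENNReal.ofReal_eq_ofReal_iff (tsum_nonneg hf) hc] at h
  exact h ▸ hs.hasSum

lemma tsum_ofReal_of_hasSum {ι : Type*} {f : ι → ℝ} {c : ℝ} (hf : ∀ i, 0 ≤ f i)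
    (h : HasSum f c) : ∑' i, ENNReal.ofReal (f i) = ENNReal.ofReal c := by
  rw [← ENNReal.ofReal_tsum_of_nonneg hf h.summable, h.tsum_eq]

lemma hasSum_pi_prod {n : ℕ} {f : Fin n → ℕ → ℝ} {c : Fin n → ℝ} (hf : ∀ i k, 0 ≤ f i k)
    (h : ∀ i, HasSum (f i) (c i)) :
    HasSum (fun j : Fin n → ℕ => ∏ i, f i (j i)) (∏ i, c i) := by
  have hc : ∀ i, 0 ≤ c i := fun i => (h i).nonneg (hf i)
  refine hasSum_of_tsum_ofReal (fun j => Finset.prod_nonneg fun i _ => hf _ _)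
    (Finset.prod_nonneg fun i _ => hc i) ?_
  simp_rw [ENNReal.ofReal_prod_of_nonneg fun i (_ : i ∈ Finset.univ) => hf i _]
  rw [ENNReal.ofReal_prod_of_nonneg fun i _ => hc i, tsum_pi_prod fun i k => ENNReal.ofReal (f i k)]
  exact Finset.prod_congr rfl fun i _ => tsum_ofReal_of_hasSum (hf i) (h i)

/-! ### The hypergeometric function -/

/-- Each factor `b + i` is at least `b`. This dominates the `₀F₁` series by the exponential series
at `|x| / b`. -/
lemma pow_le_ascPochhammer {b : ℝ} (hb : 0 < b) (k : ℕ) :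
    b ^ k ≤ (ascPochhammer ℝ k).eval b := by
  induction k with
  | zero => simp
  | succ k ih =>
    rw [ascPochhammer_succ_eval, pow_succ]
    have hk : (0 : ℝ) ≤ k := k.cast_nonneg
    exact mul_le_mul ih (by linarith) hb.le (ascPochhammer_pos k b hb).le

lemma gamma_add_natCast {b : ℝ} (hb : 0 < b) (k : ℕ) :
    Real.Gamma (b + k) = (ascPochhammer ℝ k).eval b * Real.Gamma b := by
  induction k with
  | zero => simp
  | succ k ih =>
    rw [ascPochhammer_succ_eval, Nat.cast_succ, ← add_assoc, Real.Gamma_add_one (by positivity), ih]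
    ring

lemma summable_hyp0F1 {b : ℝ} (hb : 0 < b) (x : ℝ) :
    Summable fun k : ℕ => 1 / (ascPochhammer ℝ k).eval b * (x ^ k / (k.factorial : ℝ)) := by
  refine Summable.of_norm_bounded (Real.summable_pow_div_factorial (|x| / b)) fun k => ?_
  have h := ascPochhammer_pos k b hb
  rw [norm_mul, norm_div, norm_div, norm_pow, Real.norm_eq_abs x, Real.norm_natCast, norm_one,
    Real.norm_of_nonneg h.le, div_pow, one_div_mul_eq_div, div_div, div_div,
    mul_comm (b ^ k)]
  gcongr
  exact pow_le_ascPochhammer hb k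

lemma hyp0F1_term_nonneg {b x : ℝ} (hb : 0 < b) (hx : 0 ≤ x) (k : ℕ) :
    0 ≤ 1 / (ascPochhammer ℝ k).eval b * (x ^ k / (k.factorial : ℝ)) := by
  have h := ascPochhammer_pos k b hb
  positivity

lemma hasSum_hyp0F1 {b : ℝ} (hb : 0 < b) (x : ℝ) :
    HasSum (fun k : ℕ => 1 / (ascPochhammer ℝ k).eval b * (x ^ k / (k.factorial : ℝ)))
      (hyp0F1 b x) :=
  (summable_hyp0F1 hb x).hasSum

lemma hyp0F1_pos {b x : ℝ} (hb : 0 < b) (hx : 0 ≤ x) : 0 < hyp0F1 b x :=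
  (summable_hyp0F1 hb x).tsum_pos (hyp0F1_term_nonneg hb hx) 0 (by simp)

/-- The terms of the expansion of `₀F₁(b; ∑ᵢ μᵢ)` as a series over multi-indices. -/
def multiTerm {n : ℕ} (b : ℝ) (μ : Fin n → ℝ) (j : Fin n → ℕ) : ℝ :=
  1 / (ascPochhammer ℝ (∑ i, j i)).eval b * ∏ i, μ i ^ j i / ((j i).factorial : ℝ)

lemma multiTerm_nonneg {n : ℕ} {b : ℝ} {μ : Fin n → ℝ} (hb : 0 < b) (hμ : ∀ i, 0 ≤ μ i)
    (j : Fin n → ℕ) : 0 ≤ multiTerm b μ j := by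
  have h := ascPochhammer_pos (∑ i, j i) b hb
  exact mul_nonneg (by positivity)
    (Finset.prod_nonneg fun i _ => div_nonneg (pow_nonneg (hμ i) _) (by positivity))

/-- The multinomial theorem: the Pochhammer factor depends only on the total degree `k`. -/
lemma sum_piAntidiag_multiTerm {n : ℕ} (b : ℝ) (μ : Fin n → ℝ) (k : ℕ) :
    ∑ j ∈ Finset.piAntidiag Finset.univ k, multiTerm b μ j =
      1 / (ascPochhammer ℝ k).eval b * ((∑ i, μ i) ^ k / (k.factorial : ℝ)) := by
  rw [Finset.sum_pow_eq_sum_piAntidiag, Finset.sum_div, Finset.mul_sum]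
  refine Finset.sum_congr rfl fun j hj => ?_
  have hk : ∑ i, j i = k := (Finset.mem_piAntidiag.1 hj).1
  have h := Nat.multinomial_spec Finset.univ j
  rw [hk] at h
  rw [multiTerm, hk, Finset.prod_div_distrib, ← h]
  have h1 : (Nat.multinomial Finset.univ j : ℝ) ≠ 0 :=
    Nat.cast_ne_zero.2 (Nat.multinomial_pos _ _).ne'
  have h2 : (∏ i, ((j i).factorial : ℝ)) ≠ 0 :=
    Finset.prod_ne_zero_iff.2 fun i _ => by positivity
  push_cast
  field_simp

/-- The terms are grouped by total degree, in `ℝ≥0∞`, where regrouping needs no prior summability.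
-/
lemma hasSum_multiTerm {n : ℕ} {b : ℝ} {μ : Fin n → ℝ} (hb : 0 < b) (hμ : ∀ i, 0 ≤ μ i) :
    HasSum (multiTerm b μ) (hyp0F1 b (∑ i, μ i)) := by
  have hs : 0 ≤ ∑ i, μ i := Finset.sum_nonneg fun i _ => hμ i
  refine hasSum_of_tsum_ofReal (multiTerm_nonneg hb hμ) (hyp0F1_pos hb hs).le ?_
  rw [← tsum_ofReal_of_hasSum (hyp0F1_term_nonneg hb hs) (hasSum_hyp0F1 hb _),
    ← ENNReal.tsum_fiberwise _ fun j : Fin n → ℕ => ∑ i, j i]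
  refine tsum_congr fun k => ?_
  have hset : (fun j : Fin n → ℕ => ∑ i, j i) ⁻¹' {k} = 
        ((Finset.piAntidiag Finset.univ k : Finset (Fin n → ℕ)) : Set (Fin n → ℕ)) := by
    ext j
    simp
  rw [hset, Finset.tsum_subtype' _ fun j => ENNReal.ofReal (multiTerm b μ j),
    ← ENNReal.ofReal_sum_of_nonneg fun j _ => multiTerm_nonneg hb hμ j,
    sum_piAntidiag_multiTerm]

/-- The series `∑ⱼ multiTerm b (t • μ) j * c j` depends continuously on `t ≥ 0`. -/
lemma continuous_tsum_multiTerm {n : ℕ} {b : ℝ} {μ : Fin n → ℝ} (hb : 0 < b) (hμ : ∀ i, 0 ≤ μ i)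
    {c : (Fin n → ℕ) → ℝ} {C : ℝ} (hc : ∀ j, |c j| ≤ C) :
    Continuous fun t : ℝ => ∑' j, multiTerm b (fun i => max t 0 * μ i) j * c j := by
  refine continuous_iff_continuousAt.2 fun t₀ => ?_
  -- The coefficients increase with `t`, so on `t < R` their values at `R`, times `C`, serve as the
  -- majorant in the Weierstrass test.
  obtain ⟨R, hR⟩ := exists_gt (max t₀ 0)
  have hR0 : 0 ≤ R := (le_max_right _ _).trans hR.le
  have hcont : ContinuousOn (fun t : ℝ => ∑' j, multiTerm b (fun i => max t 0 * μ i) j * c j)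
      (Set.Iio R) := by
    refine continuousOn_tsum (u := fun j => multiTerm b (fun i => R * μ i) j * C) (fun j => ?_)
      ((hasSum_multiTerm hb fun i => mul_nonneg hR0 (hμ i)).summable.mul_right C)
      fun j t ht => ?_
    · unfold multiTerm
      fun_prop
    · rw [norm_mul, Real.norm_of_nonneg
        (multiTerm_nonneg hb (fun i => mul_nonneg (le_max_right _ _) (hμ i)) j), Real.norm_eq_abs]
      refine mul_le_mul ?_ (hc j) (abs_nonneg _)
        (multiTerm_nonneg hb (fun i => mul_nonneg hR0 (hμ i)) j)
      have h := ascPochhammer_pos (∑ i, j i) b hb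
      unfold multiTerm
      refine mul_le_mul_of_nonneg_left (Finset.prod_le_prod
        (fun i _ => div_nonneg (pow_nonneg (mul_nonneg (le_max_right _ _) (hμ i)) _)
          (by positivity)) fun i _ => ?_) (by positivity)
      have hmax : max t 0 ≤ R := max_le (le_of_lt ht) hR0
      have := hμ i
      dsimp only
      gcongr
  exact hcont.continuousAt (Iio_mem_nhds ((le_max_left _ _).trans_lt hR))

/-! ### The simplex and simplicial coordinates on the orthant -/

lemma sum_complete {D : ℕ} (x : Fin D → ℝ) : ∑ i, complete x i = 1 := by
  simp [complete, Fin.sum_univ_castSucc]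

/-- The bounds `x i < 1` are redundant: a nonnegative coordinate is at most the sum of all of them.
-/
lemma mem_simplex_iff {D : ℕ} {x : Fin D → ℝ} : x ∈ simplex D ↔ ∀ i, 0 < complete x i := by
  have hsnoc : (∀ i, 0 < complete x i) ↔ (∀ i, 0 < x i) ∧ ∑ i, x i < 1 := by
    simp [complete, Fin.forall_fin_succ', sub_pos]
  rw [hsnoc]
  refine ⟨fun h => ⟨fun i => (h.1 i).1, h.2⟩, fun h => ⟨fun i => ⟨h.1 i, ?_⟩, h.2⟩⟩
  exact (Finset.single_le_sum (fun k _ => (h.1 k).le) (Finset.mem_univ i)).trans_lt h.2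

@[fun_prop]
lemma measurable_complete {D : ℕ} : Measurable (complete (D := D)) := by
  refine measurable_pi_iff.2 fun i => ?_
  induction i using Fin.lastCases with
  | last => simp only [complete, Fin.snoc_last]; fun_prop
  | cast i => simp only [complete, Fin.snoc_castSucc]; fun_prop

lemma measurableSet_simplex (D : ℕ) : MeasurableSet (simplex D) := by
  have : simplex D = complete ⁻¹' Set.univ.pi fun _ => Set.Ioi 0 := by
    ext x
    simp [mem_simplex_iff]
  rw [this]
  exact measurable_complete (MeasurableSet.univ_pi fun _ => measurableSet_Ioi)

lemma smul_complete {D : ℕ} (s : ℝ) (x : Fin D → ℝ) :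
    Fin.snoc (α := fun _ => ℝ) (s • x) (s - ∑ i, (s • x) i) = s • complete x := by
  ext i
  induction i using Fin.lastCases with
  | last => simp [complete, mul_sub, Finset.mul_sum]
  | cast i => simp [complete]

lemma sum_smul_complete {D : ℕ} (s : ℝ) (x : Fin D → ℝ) : ∑ i, (s • complete x) i = s := by
  simp [← Finset.mul_sum, sum_complete]

lemma normalized_smul_complete {D : ℕ} {s : ℝ} (hs : s ≠ 0) (x : Fin D → ℝ) :
    normalized (s • complete x) = x := by
  ext i
  rw [normalized, sum_smul_complete]
  simp [complete, hs]

@[fun_prop]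
lemma measurable_normalized {D : ℕ} : Measurable (normalized (D := D)) := by
  unfold normalized
  fun_prop

lemma lintegral_comp_smul_pi {D : ℕ} {G : (Fin D → ℝ) → ℝ≥0∞} (hG : Measurable G) {s : ℝ}
    (hs : 0 < s) : ∫⁻ x, G x = ENNReal.ofReal (s ^ D) * ∫⁻ x, G (s • x) := by
  rw [← lintegral_map hG (measurable_const_smul s), Measure.map_addHaar_smul _ hs.ne',
    lintegral_smul_measure, smul_eq_mul, ← mul_assoc, ← ENNReal.ofReal_mul (by positivity),
    Module.finrank_fin_fun, abs_of_pos (by positivity), mul_inv_cancel₀ (by positivity),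
    ENNReal.ofReal_one, one_mul]

/-- For fixed `x`, passing from the last coordinate to the total sum is a translation, hence
preserves Lebesgue measure. -/
lemma lintegral_snoc {D : ℕ} {F : (Fin (D + 1) → ℝ) → ℝ≥0∞} (hF : Measurable F) :
    ∫⁻ y, F y = ∫⁻ s : ℝ, ∫⁻ x : Fin D → ℝ,
      F (Fin.snoc (α := fun _ => ℝ) x (s - ∑ i, x i)) := by
  have hsnoc : Measurable fun p : ℝ × (Fin D → ℝ) => Fin.snoc (α := fun _ => ℝ) p.2 p.1 := by
    refine measurable_pi_iff.2 fun i => ?_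
    induction i using Fin.lastCases with
    | last => simp only [Fin.snoc_last]; fun_prop
    | cast i => simp only [Fin.snoc_castSucc]; fun_prop
  have h : ∫⁻ y, F y = ∫⁻ p : ℝ × (Fin D → ℝ), F (Fin.snoc (α := fun _ => ℝ) p.2 p.1) := by
    rw [← (volume_preserving_piFinSuccAbove (fun _ : Fin (D + 1) => ℝ) (Fin.last D)).symm.map_eq,
      lintegral_map_equiv]
    simp_rw [MeasurableEquiv.piFinSuccAbove_symm_apply, Fin.insertNthEquiv, Equiv.coe_fn_mk,
      Fin.insertNth_last']
  have hFs : Measurable fun p : ℝ × (Fin D → ℝ) => F (Fin.snoc (α := fun _ => ℝ) p.2 p.1) :=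
    hF.comp hsnoc
  rw [h, Measure.volume_eq_prod, lintegral_prod_symm' _ hFs]
  refine (lintegral_congr fun x : Fin D → ℝ => (lintegral_sub_right_eq_self
    (fun u : ℝ => F (Fin.snoc (α := fun _ => ℝ) x u)) (∑ i, x i)).symm).trans ?_
  refine lintegral_lintegral_swap ?_
  have hq : Measurable fun q : (Fin D → ℝ) × ℝ => (q.2 - ∑ i, q.1 i, q.1) := by fun_prop
  exact (hFs.comp hq).aemeasurable

/-- Integration over the positive orthant in the coordinates `y = s • complete x`, where `s` is the
sum of the coordinates of `y`. -/
lemma setLIntegral_orthant {D : ℕ} {F : (Fin (D + 1) → ℝ) → ℝ≥0∞} (hF : Measurable F) :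
    ∫⁻ y in Set.univ.pi fun _ => Set.Ioi 0, F y =
      ∫⁻ s in Set.Ioi 0, ∫⁻ x in simplex D, ENNReal.ofReal (s ^ D) * F (s • complete x) := by
  have hO : MeasurableSet (Set.univ.pi fun _ : Fin (D + 1) => Set.Ioi (0 : ℝ)) :=
    MeasurableSet.univ_pi fun _ => measurableSet_Ioi
  rw [← lintegral_indicator hO, lintegral_snoc (hF.indicator hO),
    ← lintegral_indicator measurableSet_Ioi]
  refine lintegral_congr fun s => ?_
  by_cases hs : 0 < s
  · rw [Set.indicator_of_mem (Set.mem_Ioi.2 hs), lintegral_comp_smul_pi _ hs,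
      lintegral_const_mul _ (by fun_prop), ← lintegral_indicator (measurableSet_simplex D)]
    · congr 1
      refine lintegral_congr fun x => ?_
      rw [smul_complete]
      have : s • complete x ∈ Set.univ.pi (fun _ : Fin (D + 1) => Set.Ioi (0 : ℝ)) ↔
          x ∈ simplex D := by
        simp [mem_simplex_iff, hs]
      by_cases hx : x ∈ simplex D
      · rw [Set.indicator_of_mem (this.2 hx), Set.indicator_of_mem hx]
      · rw [Set.indicator_of_notMem (mt this.1 hx), Set.indicator_of_notMem hx]
    · refine (hF.indicator hO).comp (measurable_pi_iff.2 fun i => ?_)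
      induction i using Fin.lastCases with
      | last => simp only [Fin.snoc_last]; fun_prop
      | cast i => simp only [Fin.snoc_castSucc]; fun_prop
  -- For `s ≤ 0` the slice misses the orthant, since positive coordinates have a positive sum.
  · rw [Set.indicator_of_notMem (by simpa using hs)]
    refine (lintegral_congr fun x => Set.indicator_of_notMem (fun h => hs ?_) _).trans
      lintegral_zero
    have hsum : ∑ i, Fin.snoc (α := fun _ => ℝ) x (s - ∑ i, x i) i = s := by
      simp [Fin.sum_univ_castSucc]
    rw [← hsum]
    exact Finset.sum_pos (fun i _ => h i trivial) Finset.univ_nonempty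

/-! ### Gamma and Dirichlet densities -/

@[fun_prop]
lemma measurable_dirichletDensity {D : ℕ} (a : Fin (D + 1) → ℝ) :
    Measurable (dirichletDensity a) := by
  unfold dirichletDensity
  fun_prop

lemma dirichletDensity_nonneg {D : ℕ} {a : Fin (D + 1) → ℝ} (ha : ∀ i, 0 < a i) {x : Fin D → ℝ}
    (hx : x ∈ simplex D) : 0 ≤ dirichletDensity a x := by
  have h1 := Real.Gamma_pos_of_pos (Finset.sum_pos (fun i _ => ha i) Finset.univ_nonempty)
  have h2 := Finset.prod_nonneg fun i (_ : i ∈ Finset.univ) => (Real.Gamma_pos_of_pos (ha i)).le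
  have h3 : 0 ≤ ∏ i, complete x i ^ (a i - 1) :=
    Finset.prod_nonneg fun i _ => Real.rpow_nonneg (mem_simplex_iff.1 hx i).le _
  unfold dirichletDensity
  positivity

/-- Because the rate is common, the exponentials multiply to `exp (-(r * s))`, free of `x`; this is
what separates `s` from `x`. -/
lemma pow_mul_prod_gammaPDFReal {D : ℕ} {a : Fin (D + 1) → ℝ} (ha : ∀ i, 0 < a i) {r s : ℝ}
    (hr : 0 < r) (hs : 0 < s) {x : Fin D → ℝ} (hx : x ∈ simplex D) :
    s ^ D * ∏ i, gammaPDFReal (a i) r ((s • complete x) i) =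
      gammaPDFReal (∑ i, a i) r s * dirichletDensity a x := by
  have hx := mem_simplex_iff.1 hx
  have hterm : ∀ i, gammaPDFReal (a i) r ((s • complete x) i) =
      r ^ a i / Real.Gamma (a i) * (s ^ (a i - 1) * complete x i ^ (a i - 1)) *
        Real.exp (-(r * (s * complete x i))) := fun i => by
    rw [Pi.smul_apply, smul_eq_mul, gammaPDFReal, if_pos (mul_pos hs (hx i)).le,
      Real.mul_rpow hs.le (hx i).le]
  simp_rw [hterm, Finset.prod_mul_distrib, Finset.prod_div_distrib]
  rw [← Real.exp_sum, ← Real.rpow_sum_of_pos hr, ← Real.rpow_sum_of_pos hs, Finset.sum_neg_distrib,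
    ← Finset.mul_sum, ← Finset.mul_sum, sum_complete, gammaPDFReal, if_pos hs.le, dirichletDensity]
  -- The `D + 1` exponents lose `D + 1` in total; the Jacobian `s ^ D` restores all but one.
  have hpow : s ^ D * s ^ (∑ i, (a i - 1)) = s ^ (∑ i, a i - 1) := by
    rw [← Real.rpow_natCast, ← Real.rpow_add hs]
    congr 1
    simp
    ring
  have h1 := (Real.Gamma_pos_of_pos
    (Finset.sum_pos (fun i _ => ha i) Finset.univ_nonempty)).ne'
  rw [← hpow]
  field_simp

/-- Discarding the null point `0` places the law on the open half-line, so that products live on the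
open orthant. -/
lemma gammaMeasure_eq_restrict (a r : ℝ) :
    gammaMeasure a r = (volume.restrict (Set.Ioi 0)).withDensity (gammaPDF a r) := by
  rw [← withDensity_indicator measurableSet_Ioi, gammaMeasure]
  refine withDensity_congr_ae ?_
  filter_upwards [compl_mem_ae_iff.2 (measure_singleton (0 : ℝ))] with y hy
  rcases lt_or_gt_of_ne hy with h | h
  · rw [Set.indicator_of_notMem (by simpa using h.le), gammaPDF_of_neg h]
  · rw [Set.indicator_of_mem (Set.mem_Ioi.2 h)]

@[fun_prop]
lemma measurable_gammaPDF (a r : ℝ) : Measurable (gammaPDF a r) :=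
  (measurable_gammaPDFReal a r).ennreal_ofReal

lemma setLIntegral_gammaPDF {a r : ℝ} (ha : 0 < a) (hr : 0 < r) :
    ∫⁻ s in Set.Ioi 0, gammaPDF a r s = 1 := by
  have := (isProbabilityMeasure_gammaMeasure ha hr).measure_univ
  rwa [gammaMeasure_eq_restrict, withDensity_apply _ MeasurableSet.univ,
    Measure.restrict_univ] at this

/-- The Dirichlet law. -/
def dirichlet {D : ℕ} (a : Fin (D + 1) → ℝ) : Measure (Fin D → ℝ) :=
  (volume.restrict (simplex D)).withDensity fun x => ENNReal.ofReal (dirichletDensity a x)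

/-- Independence of the sum and the proportions of gamma variables with a common rate, in integral
form. -/
lemma setLIntegral_orthant_gammaPDF {D : ℕ} {a : Fin (D + 1) → ℝ} (ha : ∀ i, 0 < a i) {r : ℝ}
    (hr : 0 < r) {F : (Fin (D + 1) → ℝ) → ℝ≥0∞} (hF : Measurable F) :
    ∫⁻ y in Set.univ.pi fun _ => Set.Ioi 0, (∏ i, gammaPDF (a i) r (y i)) * F y =
      ∫⁻ s in Set.Ioi 0, gammaPDF (∑ i, a i) r s * ∫⁻ x, F (s • complete x) ∂(dirichlet a) := by
  have hm : Measurable fun y : Fin (D + 1) → ℝ => ∏ i, gammaPDF (a i) r (y i) :=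
    Finset.measurable_prod _ fun i _ => (measurable_gammaPDF _ _).comp (measurable_pi_apply i)
  rw [setLIntegral_orthant (F := fun y => (∏ i, gammaPDF (a i) r (y i)) * F y) (hm.mul hF)]
  refine setLIntegral_congr_fun measurableSet_Ioi fun s hs => ?_
  have hFs : Measurable fun x : Fin D → ℝ => F (s • complete x) := by fun_prop
  rw [dirichlet, lintegral_withDensity_eq_lintegral_mul _ (by fun_prop) hFs,
    ← lintegral_const_mul _ (by fun_prop)]
  refine setLIntegral_congr_fun (measurableSet_simplex D) fun x hx => ?_
  have hsum : 0 < ∑ i, a i := Finset.sum_pos (fun i _ => ha i) Finset.univ_nonempty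
  simp only [gammaPDF, Pi.mul_apply]
  rw [← ENNReal.ofReal_prod_of_nonneg fun i _ => gammaPDFReal_nonneg (ha i) hr _, ← mul_assoc,
    ← mul_assoc, ← ENNReal.ofReal_mul (pow_nonneg (le_of_lt hs) _),
    pow_mul_prod_gammaPDFReal ha hr hs hx, ENNReal.ofReal_mul (gammaPDFReal_nonneg hsum hr _)]

/-- With `F = 1` in the factorization every gamma integral equals `1`, which leaves the Dirichlet
mass; no Beta integral is needed. -/
lemma isProbabilityMeasure_dirichlet {D : ℕ} {a : Fin (D + 1) → ℝ} (ha : ∀ i, 0 < a i) :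
    IsProbabilityMeasure (dirichlet a) := by
  have h := setLIntegral_orthant_gammaPDF ha one_pos (F := fun _ => 1) measurable_const
  simp_rw [mul_one, lintegral_one] at h
  rw [volume_pi, Measure.restrict_pi_pi, lintegral_pi_prod _ fun i => measurable_gammaPDF _ _,
    lintegral_mul_const _ (by fun_prop), setLIntegral_gammaPDF
      (Finset.sum_pos (fun i _ => ha i) Finset.univ_nonempty) one_pos] at h
  simp_rw [setLIntegral_gammaPDF (ha _) one_pos, Finset.prod_const_one, one_mul] at h
  exact ⟨h.symm⟩

/-! ### The joint law of the Poisson and chi-squared variables -/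

lemma poissonMeasure_half_singleton {l : ℝ} (hl : 0 ≤ l) (m : ℕ) :
    poissonMeasure (l / 2).toNNReal {m} =
      ENNReal.ofReal (Real.exp (-(l / 2)) * (l / 2) ^ m / m.factorial) := by
  rw [poissonMeasure_singleton, Real.coe_toNNReal _ (by positivity)]

instance sFinite_chiSquared (g : ℝ) : SFinite (chiSquared g) := by
  unfold chiSquared gammaMeasure
  infer_instance

lemma measurable_poissonChiSquared_density (a l : ℝ) :
    Measurable fun p : ℕ × ℝ =>
      poissonMeasure (l / 2).toNNReal {p.1} * gammaPDF (a + p.1) (1 / 2) p.2 :=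
  measurable_from_prod_countable_right fun m =>
    (measurable_gammaPDF (a + m) (1 / 2)).const_mul (poissonMeasure (l / 2).toNNReal {m})

lemma poissonChiSquared_eq_withDensity (a l : ℝ) :
    poissonChiSquared (2 * a) l =
      ((Measure.count : Measure ℕ).prod (volume.restrict (Set.Ioi (0 : ℝ)))).withDensity
        fun p => poissonMeasure (l / 2).toNNReal {p.1} * gammaPDF (a + p.1) (1 / 2) p.2 := by
  refine Measure.ext_of_lintegral _ fun f hf => ?_
  have hd := measurable_poissonChiSquared_density a l
  rw [poissonChiSquared, lintegral_sum_measure, lintegral_withDensity_eq_lintegral_mul _ hd hf,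
    lintegral_prod _ (hd.mul hf).aemeasurable, lintegral_count]
  refine tsum_congr fun m => ?_
  have hfm : Measurable fun y => f (m, y) := by fun_prop
  have hg : (2 * a + 2 * m) / 2 = a + (m : ℝ) := by ring
  simp only [Pi.mul_apply, mul_assoc]
  rw [lintegral_smul_measure, smul_eq_mul, Measure.dirac_prod, lintegral_map hf (by fun_prop), chiSquared, hg,
    gammaMeasure_eq_restrict, lintegral_withDensity_eq_lintegral_mul _ (by fun_prop) hfm,
    ← lintegral_const_mul _ ((measurable_gammaPDF _ _).mul hfm)]
  rfl

lemma isProbabilityMeasure_chiSquared {a : ℝ} (ha : 0 < a) (m : ℕ) :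
    IsProbabilityMeasure (chiSquared (2 * a + 2 * m)) :=
  isProbabilityMeasure_gammaMeasure (by positivity) (by norm_num)

lemma isProbabilityMeasure_poissonChiSquared {a : ℝ} (ha : 0 < a) (l : ℝ) :
    IsProbabilityMeasure (poissonChiSquared (2 * a) l) := by
  refine ⟨?_⟩
  have h : ∀ m : ℕ, ((Measure.dirac m).prod (chiSquared (2 * a + 2 * m))) Set.univ = 1 := fun m =>
    have := isProbabilityMeasure_chiSquared ha m
    measure_univ
  rw [poissonChiSquared, Measure.sum_apply _ MeasurableSet.univ]
  simp only [Measure.smul_apply, h, smul_eq_mul, mul_one]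
  rw [← measure_univ (μ := poissonMeasure (l / 2).toNNReal), ← Measure.tsum_indicator_apply_singleton
    _ _ MeasurableSet.univ]
  simp

lemma map_snd_poissonChiSquared (g l : ℝ) :
    (poissonChiSquared g l).map Prod.snd = noncentralChiSquared g l := by
  rw [poissonChiSquared, noncentralChiSquared, Measure.map_sum measurable_snd.aemeasurable]
  congr 1
  ext1 m
  rw [Measure.map_smul, Measure.map_snd_prod]
  simp

/-- The joint law of the vectors `M` and `Z`, where the pairs `(Mᵢ, Zᵢ)` are independent. -/
def jointLaw {n : ℕ} (α lam : Fin n → ℝ) : Measure ((Fin n → ℕ) × (Fin n → ℝ)) :=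
  (Measure.pi fun i => poissonChiSquared (2 * α i) (lam i)).map
    (MeasurableEquiv.arrowProdEquivProdArrow ℕ ℝ (Fin n))

/-- Each pair has a density for counting times Lebesgue measure, so the product law has the product
density; Tonelli then sums over the discrete part. -/
lemma lintegral_jointLaw {n : ℕ} {α : Fin n → ℝ} (hα : ∀ i, 0 < α i) (lam : Fin n → ℝ)
    {F : (Fin n → ℕ) × (Fin n → ℝ) → ℝ≥0∞} (hF : Measurable F) :
    ∫⁻ p, F p ∂(jointLaw α lam) =
      ∑' j : Fin n → ℕ, (∏ i, poissonMeasure (lam i / 2).toNNReal {j i}) *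
        ∫⁻ y in Set.univ.pi fun _ => Set.Ioi 0,
          (∏ i, gammaPDF (α i + j i) (1 / 2) (y i)) * F (j, y) := by
  let d : Fin n → ℕ × ℝ → ℝ≥0∞ := fun i p =>
    poissonMeasure (lam i / 2).toNNReal {p.1} * gammaPDF (α i + p.1) (1 / 2) p.2
  have hd : ∀ i, Measurable (d i) := fun i => measurable_poissonChiSquared_density _ _
  have hchi : ∀ i, ((Measure.count : Measure ℕ).prod
      (volume.restrict (Set.Ioi (0 : ℝ)))).withDensity (d i) = poissonChiSquared (2 * α i) (lam i) :=
    fun i => (poissonChiSquared_eq_withDensity _ _).symm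
  have hsf : ∀ i, SigmaFinite (((Measure.count : Measure ℕ).prod
      (volume.restrict (Set.Ioi (0 : ℝ)))).withDensity (d i)) := fun i => by
    have := isProbabilityMeasure_poissonChiSquared (hα i) (lam i)
    rw [hchi]
    infer_instance
  have hprod : Measurable fun p : Fin n → ℕ × ℝ => ∏ i, d i (p i) :=
    Finset.measurable_prod _ fun i _ => (hd i).comp (measurable_pi_apply i)
  have hG : Measurable fun p : (Fin n → ℕ) × (Fin n → ℝ) =>
      (∏ i, d i (p.1 i, p.2 i)) * F p := by
    refine Measurable.mul (Finset.measurable_prod _ fun i _ => (hd i).comp ?_) hF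
    fun_prop
  rw [jointLaw, lintegral_map_equiv]
  simp_rw [← hchi]
  rw [pi_withDensity _ hd, lintegral_withDensity_eq_lintegral_mul _ hprod
    (g := fun a => F (MeasurableEquiv.arrowProdEquivProdArrow ℕ ℝ (Fin n) a))
    (hF.comp (MeasurableEquiv.measurable _))]
  refine ((measurePreserving_arrowProdEquivProdArrow ℕ ℝ (Fin n) (fun _ => Measure.count)
    (fun _ => volume.restrict (Set.Ioi 0))).lintegral_comp hG).trans ?_
  rw [lintegral_prod _ hG.aemeasurable, pi_count, lintegral_count]
  refine tsum_congr fun j => ?_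
  have hj : Measurable fun y : Fin n → ℝ => (∏ i, gammaPDF (α i + j i) (1 / 2) (y i)) * F (j, y) :=
    Measurable.mul (Finset.measurable_prod _ fun i _ =>
      (measurable_gammaPDF _ _).comp (measurable_pi_apply i)) (by fun_prop)
  rw [← lintegral_const_mul _ hj, volume_pi, Measure.restrict_pi_pi]
  simp only [d, Finset.prod_mul_distrib, mul_assoc]

/-! ### The conditional law given the sum -/

/-- The conditional probability that `M = j` given that the sum is `s`, where `μ = λ / 4`. -/
def mixtureWeight {n : ℕ} (b : ℝ) (μ : Fin n → ℝ) (s : ℝ) (j : Fin n → ℕ) : ℝ :=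
  multiTerm b (fun i => max s 0 * μ i) j / hyp0F1 b (∑ i, max s 0 * μ i)

section mixtureWeight

variable {n : ℕ} {b : ℝ} {μ : Fin n → ℝ}

lemma hyp0F1_sum_pos (hb : 0 < b) (hμ : ∀ i, 0 ≤ μ i) (s : ℝ) :
    0 < hyp0F1 b (∑ i, max s 0 * μ i) :=
  hyp0F1_pos hb (Finset.sum_nonneg fun i _ => mul_nonneg (le_max_right _ _) (hμ i))

lemma mixtureWeight_nonneg (hb : 0 < b) (hμ : ∀ i, 0 ≤ μ i) (s : ℝ) (j : Fin n → ℕ) :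
    0 ≤ mixtureWeight b μ s j :=
  div_nonneg (multiTerm_nonneg hb (fun i => mul_nonneg (le_max_right _ _) (hμ i)) j)
    (hyp0F1_sum_pos hb hμ s).le

lemma hasSum_mixtureWeight (hb : 0 < b) (hμ : ∀ i, 0 ≤ μ i) (s : ℝ) :
    HasSum (mixtureWeight b μ s) 1 := by
  have h := (hasSum_multiTerm hb fun i => mul_nonneg (le_max_right s 0) (hμ i)).div_const
    (hyp0F1 b (∑ i, max s 0 * μ i))
  rwa [div_self (hyp0F1_sum_pos hb hμ s).ne'] at h

lemma tsum_ofReal_mixtureWeight (hb : 0 < b) (hμ : ∀ i, 0 ≤ μ i) (s : ℝ) :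
    ∑' j, ENNReal.ofReal (mixtureWeight b μ s j) = 1 := by
  rw [tsum_ofReal_of_hasSum (mixtureWeight_nonneg hb hμ s) (hasSum_mixtureWeight hb hμ s),
    ENNReal.ofReal_one]

lemma continuous_hyp0F1_sum (hb : 0 < b) (hμ : ∀ i, 0 ≤ μ i) :
    Continuous fun s : ℝ => hyp0F1 b (∑ i, max s 0 * μ i) := by
  refine (continuous_tsum_multiTerm hb hμ (c := fun _ => 1) (C := 1) (by simp)).congr fun s => ?_
  simp_rw [mul_one]
  exact (hasSum_multiTerm hb fun i => mul_nonneg (le_max_right _ _) (hμ i)).tsum_eq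

lemma continuous_tsum_mixtureWeight (hb : 0 < b) (hμ : ∀ i, 0 ≤ μ i) {c : (Fin n → ℕ) → ℝ} {C : ℝ}
    (hc : ∀ j, |c j| ≤ C) : Continuous fun s : ℝ => ∑' j, mixtureWeight b μ s j * c j := by
  refine ((continuous_tsum_multiTerm hb hμ hc).div (continuous_hyp0F1_sum hb hμ)
    fun s => (hyp0F1_sum_pos hb hμ s).ne').congr fun s => ?_
  simp_rw [mixtureWeight, div_mul_eq_mul_div]
  exact tsum_div_const.symm

lemma measurable_mixtureWeight (hb : 0 < b) (hμ : ∀ i, 0 ≤ μ i) (j : Fin n → ℕ) :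
    Measurable fun s => mixtureWeight b μ s j := by
  refine Measurable.div ?_ (continuous_hyp0F1_sum hb hμ).measurable
  unfold multiTerm
  fun_prop

/-- The conditional law of `M` given the sum, as a Markov kernel. -/
def weightKernel (hb : 0 < b) (hμ : ∀ i, 0 ≤ μ i) : Kernel ℝ (Fin n → ℕ) where
  toFun s := Measure.sum fun j => ENNReal.ofReal (mixtureWeight b μ s j) • Measure.dirac j
  measurable' := by
    refine Measure.measurable_of_measurable_coe _ fun S hS => ?_
    simp_rw [Measure.sum_apply _ hS, Measure.smul_apply, smul_eq_mul]
    exact Measurable.tsum fun j =>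
      (measurable_mixtureWeight hb hμ j).ennreal_ofReal.mul_const _

lemma lintegral_weightKernel (hb : 0 < b) (hμ : ∀ i, 0 ≤ μ i) (s : ℝ) (f : (Fin n → ℕ) → ℝ≥0∞) :
    ∫⁻ j, f j ∂(weightKernel hb hμ s) = ∑' j, ENNReal.ofReal (mixtureWeight b μ s j) * f j := by
  change ∫⁻ j, f j ∂(Measure.sum fun j => _) = _
  rw [lintegral_sum_measure]
  simp_rw [lintegral_smul_measure, lintegral_dirac, smul_eq_mul]

instance isMarkovKernel_weightKernel (hb : 0 < b) (hμ : ∀ i, 0 ≤ μ i) :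
    IsMarkovKernel (weightKernel hb hμ) := by
  refine ⟨fun s => ⟨?_⟩⟩
  rw [← lintegral_one, lintegral_weightKernel]
  simp_rw [mul_one]
  exact tsum_ofReal_mixtureWeight hb hμ s

lemma weightKernel_singleton (hb : 0 < b) (hμ : ∀ i, 0 ≤ μ i) (s : ℝ) (j : Fin n → ℕ) :
    (weightKernel hb hμ s) {j} = ENNReal.ofReal (mixtureWeight b μ s j) :=
  Measure.sum_smul_dirac_singleton

lemma weightKernel_real_singleton (hb : 0 < b) (hμ : ∀ i, 0 ≤ μ i) (s : ℝ) (j : Fin n → ℕ) :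
    (weightKernel hb hμ s).real {j} = mixtureWeight b μ s j := by
  rw [measureReal_def, weightKernel_singleton,
    ENNReal.toReal_ofReal (mixtureWeight_nonneg hb hμ s j)]

lemma continuous_integral_weightKernel (hb : 0 < b) (hμ : ∀ i, 0 ≤ μ i) {f : (Fin n → ℕ) → ℝ}
    {C : ℝ} (hf : ∀ j, |f j| ≤ C) : Continuous fun s => ∫ j, f j ∂(weightKernel hb hμ s) := by
  refine (continuous_tsum_mixtureWeight hb hμ hf).congr fun s => ?_
  rw [integral_countable (Integrable.of_bound (by fun_prop) C (ae_of_all _ hf))]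
  simp_rw [weightKernel_real_singleton, smul_eq_mul]

end mixtureWeight

/-- The Dirichlet laws with shape parameters `α + j`, as a kernel in `j`. -/
def dirichletKernel {D : ℕ} (α : Fin (D + 1) → ℝ) : Kernel (Fin (D + 1) → ℕ) (Fin D → ℝ) :=
  Kernel.ofFunOfCountable fun j => dirichlet fun i => α i + j i

lemma isMarkovKernel_dirichletKernel {D : ℕ} {α : Fin (D + 1) → ℝ} (hα : ∀ i, 0 < α i) :
    IsMarkovKernel (dirichletKernel α) :=
  ⟨fun j => isProbabilityMeasure_dirichlet fun i => add_pos_of_pos_of_nonneg (hα i) (by simp)⟩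

/-- The density of the sum of independent non-central chi-squared variables, where `μ = λ / 4`. -/
def sumDensity {n : ℕ} (b : ℝ) (μ : Fin n → ℝ) (s : ℝ) : ℝ :=
  (∏ i, Real.exp (-(2 * μ i))) * gammaPDFReal b (1 / 2) s * hyp0F1 b (∑ i, max s 0 * μ i)

/-- Bayes' formula. The Poisson mean `2 * μ i`, the rate power `(1 / 2) ^ j i` and `s ^ j i` combine
to `(s * μ i) ^ j i`, while `Γ (b + j⁺)` supplies the Pochhammer factor. -/
lemma prod_poisson_mul_gammaPDFReal {n : ℕ} {b : ℝ} (hb : 0 < b) {μ : Fin n → ℝ}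
    (hμ : ∀ i, 0 ≤ μ i) {s : ℝ} (hs : 0 < s) (j : Fin n → ℕ) :
    (∏ i, Real.exp (-(2 * μ i)) * (2 * μ i) ^ j i / (j i).factorial) *
        gammaPDFReal (b + (∑ i, j i : ℕ)) (1 / 2) s =
      sumDensity b μ s * mixtureWeight b μ s j := by
  have h1 := (hyp0F1_sum_pos hb hμ s).ne'
  have h2 := (ascPochhammer_pos (∑ i, j i) b hb).ne'
  have h3 := (Real.Gamma_pos_of_pos hb).ne'
  have h4 : ∏ i, (max s 0 * μ i) ^ j i / ((j i).factorial : ℝ) =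
      (∏ i, (2 * μ i) ^ j i / ((j i).factorial : ℝ)) * ((1 / 2) ^ (∑ i, j i) * s ^ (∑ i, j i)) := by
    rw [← mul_pow, ← Finset.prod_pow_eq_pow_sum, ← Finset.prod_mul_distrib]
    refine Finset.prod_congr rfl fun i _ => ?_
    rw [max_eq_left hs.le, div_mul_eq_mul_div, ← mul_pow]
    congr 2
    ring
  have h5 : s ^ (b + (∑ i, j i : ℕ) - 1) = s ^ (b - 1) * s ^ (∑ i, j i) := by
    rw [← Real.rpow_natCast s, ← Real.rpow_add hs]
    congr 1
    ring
  have h6 : (1 / 2 : ℝ) ^ (b + (∑ i, j i : ℕ)) = (1 / 2) ^ b * (1 / 2) ^ (∑ i, j i) := by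
    rw [← Real.rpow_natCast (1 / 2 : ℝ), ← Real.rpow_add (by norm_num)]
  rw [sumDensity, mixtureWeight, multiTerm, gammaPDFReal, gammaPDFReal, if_pos hs.le, if_pos hs.le,
    gamma_add_natCast hb, h4, h5, h6]
  simp_rw [mul_div_assoc, Finset.prod_mul_distrib]
  field_simp

lemma sumDensity_pos {n : ℕ} {b : ℝ} (hb : 0 < b) {μ : Fin n → ℝ} (hμ : ∀ i, 0 ≤ μ i) {s : ℝ}
    (hs : 0 < s) : 0 < sumDensity b μ s :=
  mul_pos (mul_pos (Finset.prod_pos fun _ _ => Real.exp_pos _)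
    (gammaPDFReal_pos hb (by norm_num) hs)) (hyp0F1_sum_pos hb hμ s)

lemma measurable_sumDensity {n : ℕ} {b : ℝ} (hb : 0 < b) {μ : Fin n → ℝ} (hμ : ∀ i, 0 ≤ μ i) :
    Measurable (sumDensity b μ) :=
  ((measurable_gammaPDFReal _ _).const_mul _).mul (continuous_hyp0F1_sum hb hμ).measurable

section jointLaw

variable {D : ℕ} {α μ : Fin (D + 1) → ℝ}

/-- The law of the sum of independent non-central chi-squared variables, where `μ = λ / 4`. -/
def sumLaw {n : ℕ} (b : ℝ) (μ : Fin n → ℝ) : Measure ℝ :=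
  (volume.restrict (Set.Ioi 0)).withDensity fun s => ENNReal.ofReal (sumDensity b μ s)

instance sFinite_sumLaw {n : ℕ} (b : ℝ) (μ : Fin n → ℝ) : SFinite (sumLaw b μ) := by
  unfold sumLaw
  infer_instance

lemma sum_shape_pos (hα : ∀ i, 0 < α i) : 0 < ∑ i, α i :=
  Finset.sum_pos (fun i _ => hα i) Finset.univ_nonempty

/-- The full disintegration: draw the sum, then `M` given the sum, then the proportions given `M`
alone. Test functions `G` of fewer variables give the pushforward identities below. -/
lemma lintegral_jointLaw_normalized (hα : ∀ i, 0 < α i) (hμ : ∀ i, 0 ≤ μ i)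
    {G : ℝ × (Fin (D + 1) → ℕ) × (Fin D → ℝ) → ℝ≥0∞} (hG : Measurable G) :
    ∫⁻ p, G (∑ i, p.2 i, p.1, normalized p.2) ∂(jointLaw α fun i => 4 * μ i) =
      ∫⁻ s, ∫⁻ j, ∫⁻ x, G (s, j, x) ∂(dirichletKernel α j)
        ∂(weightKernel (sum_shape_pos hα) hμ s) ∂(sumLaw (∑ i, α i) μ) := by
  have hb := sum_shape_pos hα
  have hmark := isMarkovKernel_dirichletKernel hα
  have hint : ∀ j, Measurable fun s => ∫⁻ x, G (s, j, x) ∂(dirichletKernel α j) := fun j =>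
    have : Measurable fun p : ℝ × (Fin D → ℝ) => G (p.1, j, p.2) := by fun_prop
    this.lintegral_prod_right'
  have hsd := (measurable_sumDensity hb hμ).ennreal_ofReal
  simp_rw [lintegral_weightKernel]
  have hsum : Measurable fun s => ∑' j, ENNReal.ofReal (mixtureWeight (∑ i, α i) μ s j) *
      ∫⁻ x, G (s, j, x) ∂(dirichletKernel α j) :=
    Measurable.tsum fun j => (measurable_mixtureWeight hb hμ j).ennreal_ofReal.mul (hint j)
  rw [lintegral_jointLaw hα _ (by fun_prop), sumLaw,
    lintegral_withDensity_eq_lintegral_mul _ hsd hsum]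
  simp only [Pi.mul_apply, ← ENNReal.tsum_mul_left]
  have hterm : ∀ j, Measurable fun s => ENNReal.ofReal (sumDensity (∑ i, α i) μ s) *
      (ENNReal.ofReal (mixtureWeight (∑ i, α i) μ s j) * ∫⁻ x, G (s, j, x) ∂(dirichletKernel α j)) :=
    fun j => hsd.mul ((measurable_mixtureWeight hb hμ j).ennreal_ofReal.mul (hint j))
  rw [lintegral_tsum fun j => (hterm j).aemeasurable]
  refine tsum_congr fun j => ?_
  have haj : ∀ i, 0 < α i + j i := fun i => add_pos_of_pos_of_nonneg (hα i) (by simp)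
  rw [setLIntegral_orthant_gammaPDF haj (by norm_num)
    (F := fun y => G (∑ i, y i, j, normalized y)) (by fun_prop), ← lintegral_const_mul]
  · refine setLIntegral_congr_fun measurableSet_Ioi fun s hs => ?_
    have hs : 0 < s := hs
    simp only [sum_smul_complete, normalized_smul_complete hs.ne']
    rw [← mul_assoc, ← mul_assoc, ← ENNReal.ofReal_mul (sumDensity_pos hb hμ hs).le,
      ← prod_poisson_mul_gammaPDFReal hb hμ hs]
    have hP : ∀ i, 0 ≤ Real.exp (-(2 * μ i)) * (2 * μ i) ^ j i / ((j i).factorial : ℝ) := fun i => by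
      have := hμ i
      positivity
    rw [ENNReal.ofReal_mul (Finset.prod_nonneg fun i _ => hP i),
      ENNReal.ofReal_prod_of_nonneg fun i _ => hP i, Finset.sum_add_distrib, ← Nat.cast_sum]
    congr 2
    refine Finset.prod_congr rfl fun i _ => ?_
    rw [poissonMeasure_half_singleton (mul_nonneg (by norm_num) (hμ i))]
    ring_nf
  · refine (measurable_gammaPDF _ _).mul ?_
    have hm : Measurable fun p : ℝ × (Fin D → ℝ) =>
        G (∑ i, (p.1 • complete p.2) i, j, normalized (p.1 • complete p.2)) := by fun_prop
    have := isProbabilityMeasure_dirichlet haj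
    exact hm.lintegral_prod_right'

lemma map_sum_jointLaw (hα : ∀ i, 0 < α i) (hμ : ∀ i, 0 ≤ μ i) :
    (jointLaw α fun i => 4 * μ i).map (fun p => ∑ i, p.2 i) = sumLaw (∑ i, α i) μ := by
  have hmark := isMarkovKernel_dirichletKernel hα
  refine Measure.ext_of_lintegral _ fun f hf => ?_
  rw [lintegral_map hf (by fun_prop)]
  exact (lintegral_jointLaw_normalized hα hμ (G := fun q => f q.1) (by fun_prop)).trans (by simp)

lemma map_sum_fst_jointLaw (hα : ∀ i, 0 < α i) (hμ : ∀ i, 0 ≤ μ i) :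
    (jointLaw α fun i => 4 * μ i).map (fun p => (∑ i, p.2 i, p.1)) =
      ((jointLaw α fun i => 4 * μ i).map fun p => ∑ i, p.2 i).compProd
        (weightKernel (sum_shape_pos hα) hμ) := by
  have hmark := isMarkovKernel_dirichletKernel hα
  refine Measure.ext_of_lintegral _ fun f hf => ?_
  rw [map_sum_jointLaw hα hμ, lintegral_map hf (by fun_prop), Measure.lintegral_compProd hf]
  exact (lintegral_jointLaw_normalized hα hμ (G := fun q => f (q.1, q.2.1)) (by fun_prop)).trans
    (by simp)

lemma map_sum_normalized_jointLaw (hα : ∀ i, 0 < α i) (hμ : ∀ i, 0 ≤ μ i) :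
    (jointLaw α fun i => 4 * μ i).map (fun p => (∑ i, p.2 i, normalized p.2)) =
      ((jointLaw α fun i => 4 * μ i).map fun p => ∑ i, p.2 i).compProd
        (dirichletKernel α ∘ₖ weightKernel (sum_shape_pos hα) hμ) := by
  have hmark := isMarkovKernel_dirichletKernel hα
  refine Measure.ext_of_lintegral _ fun f hf => ?_
  rw [map_sum_jointLaw hα hμ, lintegral_map hf (by fun_prop), Measure.lintegral_compProd hf]
  refine (lintegral_jointLaw_normalized hα hμ (G := fun q => f (q.1, q.2.2)) (by fun_prop)).trans
    (lintegral_congr fun s => ?_)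
  rw [Kernel.lintegral_comp _ _ _ (by fun_prop)]

/-- The density is strictly positive on the half-line, so every `t > 0` is a support point. -/
lemma sumLaw_pos {n : ℕ} {b : ℝ} {μ : Fin n → ℝ} (hb : 0 < b) (hμ : ∀ i, 0 ≤ μ i) {t : ℝ}
    (ht : 0 < t) {U : Set ℝ} (hU : U ∈ 𝓝 t) : 0 < sumLaw b μ U := by
  obtain ⟨V, hVU, hV, htV⟩ := mem_nhds_iff.1 (inter_mem hU (Ioi_mem_nhds ht))
  refine lt_of_lt_of_le ?_ (measure_mono (hVU.trans Set.inter_subset_left))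
  rw [pos_iff_ne_zero, sumLaw, withDensity_apply _ hV.measurableSet,
    Measure.restrict_restrict hV.measurableSet,
    Set.inter_eq_left.2 (hVU.trans Set.inter_subset_right), ← pos_iff_ne_zero,
    setLIntegral_pos_iff (measurable_sumDensity hb hμ).ennreal_ofReal]
  refine (hV.measure_pos volume ⟨t, htV⟩).trans_le (measure_mono fun s hs => ⟨?_, hs⟩)
  exact (ENNReal.ofReal_pos.2 (sumDensity_pos hb hμ (hVU hs).2)).ne'

end jointLaw

/-! ### Conditional laws at a point -/

/-- If the integrals of some `f` differed at `t`, by continuity they would differ on a neighbourhood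
of `t`. That neighbourhood has positive mass, yet two versions agree almost everywhere. -/
lemma IsCondLawAt.unique {Ω E : Type*} [MeasurableSpace Ω] [TopologicalSpace E]
    [MeasurableSpace E] [HasOuterApproxClosed E] [BorelSpace E] [StandardBorelSpace E]
    {P : Measure Ω} [IsFiniteMeasure P] {X : Ω → E} {T : Ω → ℝ} {t : ℝ} {ν ν' : Measure E}
    (h : IsCondLawAt P X T t ν) (h' : IsCondLawAt P X T t ν') : ν' = ν := by
  obtain ⟨hpos, κ, hκ, hκeq, hκc, rfl⟩ := h
  obtain ⟨-, κ', hκ', hκeq', hκc', rfl⟩ := h'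
  have hae : ∀ᵐ s ∂(P.map T), κ' s = κ s := Kernel.ae_eq_of_compProd_eq (hκeq'.symm.trans hκeq)
  refine ext_of_forall_integral_eq_of_IsFiniteMeasure fun f => ?_
  by_contra hne
  have hev : ∀ᶠ s in 𝓝 t, ∫ x, f x ∂(κ' s) - ∫ x, f x ∂(κ s) ≠ 0 :=
    ((hκc' f).sub (hκc f)).eventually_ne (sub_ne_zero.2 hne)
  have hnull : P.map T {s | ¬κ' s = κ s} = 0 := ae_iff.1 hae
  refine (hpos _ hev).ne' (measure_mono_null ?_ hnull)
  intro s hs hs'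
  refine hs ?_
  rw [hs', sub_self]

lemma isCondLawAt_iff_eq {Ω E : Type*} [MeasurableSpace Ω] [TopologicalSpace E]
    [MeasurableSpace E] [HasOuterApproxClosed E] [BorelSpace E] [StandardBorelSpace E]
    {P : Measure Ω} [IsFiniteMeasure P] {X : Ω → E} {T : Ω → ℝ} {t : ℝ} {ν ν' : Measure E}
    (h : IsCondLawAt P X T t ν) : IsCondLawAt P X T t ν' ↔ ν' = ν :=
  ⟨fun h' => h.unique h', fun h' => h' ▸ h⟩

lemma isCondLawAt_weightKernel {D : ℕ} {α μ : Fin (D + 1) → ℝ} (hα : ∀ i, 0 < α i)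
    (hμ : ∀ i, 0 ≤ μ i) {Ω : Type*} [MeasurableSpace Ω] {P : Measure Ω}
    {V : Ω → (Fin (D + 1) → ℕ) × (Fin (D + 1) → ℝ)}
    (hV : HasLaw V (jointLaw α fun i => 4 * μ i) P) {t : ℝ} (ht : 0 < t) :
    IsCondLawAt P (fun ω => (V ω).1) (fun ω => ∑ i, (V ω).2 i) t
      (weightKernel (sum_shape_pos hα) hμ t) := by
  have hT : P.map (fun ω => ∑ i, (V ω).2 i) =
      (jointLaw α fun i => 4 * μ i).map fun p => ∑ i, p.2 i := by
    rw [← hV.map_eq, AEMeasurable.map_map_of_aemeasurable (by fun_prop) hV.aemeasurable]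
    rfl
  refine ⟨fun U hU => ?_, weightKernel (sum_shape_pos hα) hμ, inferInstance, ?_, fun f => ?_, rfl⟩
  · rw [hT, map_sum_jointLaw hα hμ]
    exact sumLaw_pos (sum_shape_pos hα) hμ ht hU
  · rw [hT, ← map_sum_fst_jointLaw hα hμ, ← hV.map_eq,
      AEMeasurable.map_map_of_aemeasurable (by fun_prop) hV.aemeasurable]
    rfl
  · exact (continuous_integral_weightKernel (sum_shape_pos hα) hμ f.norm_coe_le_norm).continuousAt

lemma isCondLawAt_dirichletKernel_comp {D : ℕ} {α μ : Fin (D + 1) → ℝ} (hα : ∀ i, 0 < α i)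
    (hμ : ∀ i, 0 ≤ μ i) {Ω : Type*} [MeasurableSpace Ω] {P : Measure Ω}
    {Y : Ω → Fin (D + 1) → ℝ}
    (hY : HasLaw Y ((jointLaw α fun i => 4 * μ i).map Prod.snd) P) {t : ℝ} (ht : 0 < t) :
    IsCondLawAt P (fun ω => normalized (Y ω)) (fun ω => ∑ i, Y ω i) t
      ((dirichletKernel α ∘ₖ weightKernel (sum_shape_pos hα) hμ) t) := by
  have hmark := isMarkovKernel_dirichletKernel hα
  have hT : P.map (fun ω => ∑ i, Y ω i) =
      (jointLaw α fun i => 4 * μ i).map fun p => ∑ i, p.2 i := by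
    have h := congrArg (Measure.map fun y : Fin (D + 1) → ℝ => ∑ i, y i) hY.map_eq
    rw [AEMeasurable.map_map_of_aemeasurable (by fun_prop) hY.aemeasurable,
      Measure.map_map (by fun_prop) measurable_snd] at h
    exact h
  refine ⟨fun U hU => ?_, dirichletKernel α ∘ₖ weightKernel (sum_shape_pos hα) hμ, inferInstance,
    ?_, fun f => ?_, rfl⟩
  · rw [hT, map_sum_jointLaw hα hμ]
    exact sumLaw_pos (sum_shape_pos hα) hμ ht hU
  · have h := congrArg
      (Measure.map fun y : Fin (D + 1) → ℝ => (∑ i, y i, normalized y)) hY.map_eq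
    rw [AEMeasurable.map_map_of_aemeasurable (by fun_prop) hY.aemeasurable,
      Measure.map_map (by fun_prop) measurable_snd] at h
    rw [hT, ← map_sum_normalized_jointLaw hα hμ]
    exact h
  -- The Dirichlet kernel does not involve `s`: the inner integrals form a sequence in `j` bounded
  -- by `‖f‖`, so continuity of the weights suffices.
  · simp_rw [Kernel.integral_comp (f.integrable _)]
    refine (continuous_integral_weightKernel (C := ‖f‖) (sum_shape_pos hα) hμ
      fun j => ?_).continuousAt
    have h := norm_integral_le_of_norm_le_const (μ := dirichletKernel α j)
      (ae_of_all _ f.norm_coe_le_norm)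
    simpa using h

/-! ### The density -/

lemma mixtureWeight_one {n : ℕ} (b : ℝ) (lam : Fin n → ℝ) (j : Fin n → ℕ) :
    mixtureWeight b (fun i => lam i / 4) 1 j =
      1 / hyp0F1 b ((∑ i, lam i) / 4) * (1 / (ascPochhammer ℝ (∑ i, j i)).eval b) *
        ∏ i, (lam i / 4) ^ j i / ((j i).factorial : ℝ) := by
  simp only [mixtureWeight, multiTerm, max_eq_left zero_le_one, one_mul, ← Finset.sum_div]
  ring

lemma dirichletDensity_add_natCast {D : ℕ} {α : Fin (D + 1) → ℝ} (hα : ∀ i, 0 < α i)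
    (j : Fin (D + 1) → ℕ) {x : Fin D → ℝ} (hx : x ∈ simplex D) :
    dirichletDensity (fun i => α i + j i) x =
      dirichletDensity α x * (ascPochhammer ℝ (∑ i, j i)).eval (∑ i, α i) *
        ∏ i, complete x i ^ j i / (ascPochhammer ℝ (j i)).eval (α i) := by
  have hx := mem_simplex_iff.1 hx
  have h1 : ∀ i, complete x i ^ (α i + j i - 1) = complete x i ^ (α i - 1) * complete x i ^ j i :=
    fun i => by
      rw [← Real.rpow_natCast (complete x i), ← Real.rpow_add (hx i)]
      congr 1
      ring
  simp_rw [dirichletDensity, Finset.sum_add_distrib, ← Nat.cast_sum,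
    gamma_add_natCast (sum_shape_pos hα), gamma_add_natCast (hα _), h1, Finset.prod_mul_distrib,
    Finset.prod_div_distrib]
  field_simp

/-- Once `(α⁺)_{j⁺}` cancels, the `j`-th term is a product over `i` of terms of `₀F₁(αᵢ; λᵢ xᵢ /
4)`, and `hasSum_pi_prod` applies. -/
lemma hasSum_mixtureDensity {D : ℕ} {α lam : Fin (D + 1) → ℝ} (hα : ∀ i, 0 < α i)
    (hlam : ∀ i, 0 ≤ lam i) {x : Fin D → ℝ} (hx : x ∈ simplex D) :
    HasSum (fun j => mixtureWeight (∑ i, α i) (fun i => lam i / 4) 1 j *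
      dirichletDensity (fun i => α i + j i) x) (perturbedDensity α lam x) := by
  have hx' := mem_simplex_iff.1 hx
  have hz : ∀ i, 0 ≤ lam i / 4 * complete x i := fun i =>
    mul_nonneg (div_nonneg (hlam i) (by norm_num)) (hx' i).le
  have h := ((hasSum_pi_prod (fun i k => hyp0F1_term_nonneg (hα i) (hz i) k)
    fun i => hasSum_hyp0F1 (hα i) _).div_const (hyp0F1 (∑ i, α i) ((∑ i, lam i) / 4))).mul_left
      (dirichletDensity α x)
  refine h.congr_fun fun j => ?_
  have h2 := (ascPochhammer_pos (∑ i, j i) _ (sum_shape_pos hα)).ne'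
  rw [mixtureWeight_one, dirichletDensity_add_natCast hα j hx]
  simp_rw [mul_pow, mul_div_assoc, Finset.prod_mul_distrib, Finset.prod_div_distrib]
  simp
  field_simp

/-- Tonelli exchanges the sum over `j` with the integral over the simplex. -/
lemma dirichletKernel_comp_eq_withDensity {D : ℕ} {α lam : Fin (D + 1) → ℝ} (hα : ∀ i, 0 < α i)
    (hlam : ∀ i, 0 ≤ lam i) (hμ : ∀ i, 0 ≤ lam i / 4) :
    (dirichletKernel α ∘ₖ weightKernel (sum_shape_pos hα) hμ) 1 =
      (volume.restrict (simplex D)).withDensity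
        fun x => ENNReal.ofReal (perturbedDensity α lam x) := by
  ext S hS
  rw [Kernel.comp_apply' _ _ _ hS, lintegral_weightKernel, withDensity_apply _ hS,
    Measure.restrict_restrict hS]
  have hmeas : ∀ j : Fin (D + 1) → ℕ, Measurable fun x : Fin D → ℝ =>
      ENNReal.ofReal (dirichletDensity (fun i => α i + j i) x) := fun j => by fun_prop
  have hdir : ∀ j, dirichletKernel α j S =
      ∫⁻ x in S ∩ simplex D, ENNReal.ofReal (dirichletDensity (fun i => α i + j i) x) := fun j => by
    rw [← Measure.restrict_restrict hS]
    exact withDensity_apply _ hS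
  simp_rw [hdir, ← lintegral_const_mul _ (hmeas _)]
  rw [← lintegral_tsum fun j => ((hmeas j).const_mul _).aemeasurable]
  refine setLIntegral_congr_fun (hS.inter (measurableSet_simplex D)) fun x hx => ?_
  have hw := mixtureWeight_nonneg (sum_shape_pos hα) hμ 1
  simp_rw [← ENNReal.ofReal_mul (hw _)]
  exact tsum_ofReal_of_hasSum (fun j => mul_nonneg (hw j) (dirichletDensity_nonneg
    (fun i => add_pos_of_pos_of_nonneg (hα i) (by simp)) hx.2)) (hasSum_mixtureDensity hα hlam hx.2)

lemma map_snd_jointLaw {n : ℕ} {α : Fin n → ℝ} (hα : ∀ i, 0 < α i) (lam : Fin n → ℝ) :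
    (jointLaw α lam).map Prod.snd =
      Measure.pi fun i => noncentralChiSquared (2 * α i) (lam i) := by
  have := fun i => isProbabilityMeasure_poissonChiSquared (hα i) (lam i)
  have hp : ∀ i, IsProbabilityMeasure
      ((poissonChiSquared (2 * α i) (lam i)).map Prod.snd) := fun i =>
    Measure.isProbabilityMeasure_map measurable_snd.aemeasurable
  simp_rw [← map_snd_poissonChiSquared]
  rw [← Measure.pi_map_pi (μ := fun i => poissonChiSquared (2 * α i) (lam i))
    (f := fun _ => Prod.snd) (hμ := fun i => inferInstance) fun i => measurable_snd.aemeasurable,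
    jointLaw, Measure.map_map measurable_snd (MeasurableEquiv.measurable _)]
  rfl

end

end CondNcDir

theorem mainTheorem1 (D : ℕ) (hD : 1 ≤ D) (α lam : Fin (D + 1) → ℝ)
    (hα : ∀ i, 0 < α i) (hlam : ∀ i, 0 ≤ lam i)
    {Ω : Type*} [MeasurableSpace Ω] (P : Measure Ω) [IsProbabilityMeasure P]
    (Y : Fin (D + 1) → Ω → ℝ)
    (hY : ∀ i, HasLaw (Y i) (CondNcDir.noncentralChiSquared (2 * α i) (lam i)) P)
    (hYind : iIndepFun Y P)
    {Ω' : Type*} [MeasurableSpace Ω'] (P' : Measure Ω') [IsProbabilityMeasure P']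
    (M : Fin (D + 1) → Ω' → ℕ) (Z : Fin (D + 1) → Ω' → ℝ)
    (hMZ : ∀ i, HasLaw (fun ω => (M i ω, Z i ω))
      (CondNcDir.poissonChiSquared (2 * α i) (lam i)) P')
    (hMZind : iIndepFun (fun i ω => (M i ω, Z i ω)) P') :
    ∃ (ν : Measure (Fin D → ℝ)) (w : Measure (Fin (D + 1) → ℕ)),
      -- `ν` is the law of `(Y₁ / Y⁺, …, Y_D / Y⁺)` given `Y⁺ = 1`
      (∀ ν' : Measure (Fin D → ℝ),
        CondNcDir.IsCondLawAt P (fun ω => CondNcDir.normalized fun i => Y i ω)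
          (fun ω => ∑ i, Y i ω) 1 ν' ↔ ν' = ν) ∧
      -- `w` is the mixture weight law: the law of `M` given `Z⁺ = 1`
      (∀ w' : Measure (Fin (D + 1) → ℕ),
        CondNcDir.IsCondLawAt P' (fun ω i => M i ω) (fun ω => ∑ i, Z i ω) 1 w' ↔ w' = w) ∧
      (∀ j : Fin (D + 1) → ℕ, w.real {j} =
        1 / CondNcDir.hyp0F1 (∑ i, α i) ((∑ i, lam i) / 4) *
          (1 / (ascPochhammer ℝ (∑ i, j i)).eval (∑ i, α i)) *
          ∏ i, (lam i / 4) ^ j i / ((j i).factorial : ℝ)) ∧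
      -- the mixture form of the density
      (∀ x ∈ CondNcDir.simplex D, Summable fun j : Fin (D + 1) → ℕ =>
        w.real {j} * CondNcDir.dirichletDensity (fun i => α i + j i) x) ∧
      ν = (volume.restrict (CondNcDir.simplex D)).withDensity
        (fun x => ENNReal.ofReal (CondNcDir.mixtureDensity w α x)) ∧
      -- the perturbation form of the density
      (∀ x ∈ CondNcDir.simplex D,
        CondNcDir.mixtureDensity w α x = CondNcDir.perturbedDensity α lam x) ∧
      ν = (volume.restrict (CondNcDir.simplex D)).withDensity
        (fun x => ENNReal.ofReal (CondNcDir.perturbedDensity α lam x)) := by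
  have hμ : ∀ i, 0 ≤ lam i / 4 := fun i => div_nonneg (hlam i) (by norm_num)
  -- The conditional laws were computed with parameter `μ = λ / 4`, the scale of the `₀F₁`
  -- arguments.
  have h4 : (fun i => 4 * (lam i / 4)) = lam := funext fun i => mul_div_cancel₀ (lam i) (by norm_num)
  have hYlaw : HasLaw (fun ω i => Y i ω)
      ((CondNcDir.jointLaw α fun i => 4 * (lam i / 4)).map Prod.snd) P := by
    rw [h4, CondNcDir.map_snd_jointLaw hα]
    exact hYind.hasLaw_pi hY
  have hVlaw : HasLaw (fun ω => ((fun i => M i ω, fun i => Z i ω) :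
      (Fin (D + 1) → ℕ) × (Fin (D + 1) → ℝ)))
      (CondNcDir.jointLaw α fun i => 4 * (lam i / 4)) P' := by
    rw [h4]
    have hpi := hMZind.hasLaw_pi hMZ
    have he : HasLaw (MeasurableEquiv.arrowProdEquivProdArrow ℕ ℝ (Fin (D + 1)))
        (CondNcDir.jointLaw α lam)
        (Measure.pi fun i => CondNcDir.poissonChiSquared (2 * α i) (lam i)) :=
      ⟨(MeasurableEquiv.measurable _).aemeasurable, rfl⟩
    exact he.comp hpi
  have hw : ∀ j, (CondNcDir.weightKernel (CondNcDir.sum_shape_pos hα) hμ 1).real {j} =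
      CondNcDir.mixtureWeight (∑ i, α i) (fun i => lam i / 4) 1 j :=
    CondNcDir.weightKernel_real_singleton _ _ 1
  have hsum : ∀ x ∈ CondNcDir.simplex D, HasSum (fun j : Fin (D + 1) → ℕ =>
      (CondNcDir.weightKernel (CondNcDir.sum_shape_pos hα) hμ 1).real {j} *
        CondNcDir.dirichletDensity (fun i => α i + j i) x)
      (CondNcDir.perturbedDensity α lam x) := fun x hx => by
    simp_rw [hw]
    exact CondNcDir.hasSum_mixtureDensity hα hlam hx
  have hν := CondNcDir.dirichletKernel_comp_eq_withDensity hα hlam hμ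
  refine ⟨_, CondNcDir.weightKernel (CondNcDir.sum_shape_pos hα) hμ 1,
    fun ν' => CondNcDir.isCondLawAt_iff_eq
      (CondNcDir.isCondLawAt_dirichletKernel_comp hα hμ hYlaw one_pos),
    fun w' => CondNcDir.isCondLawAt_iff_eq
      (CondNcDir.isCondLawAt_weightKernel hα hμ hVlaw one_pos),
    fun j => (hw j).trans (CondNcDir.mixtureWeight_one _ _ _),
    fun x hx => (hsum x hx).summable, hν.trans (withDensity_congr_ae ?_),
    fun x hx => (hsum x hx).tsum_eq, hν⟩
  filter_upwards [ae_restrict_mem (CondNcDir.measurableSet_simplex D)] with x hx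
  rw [CondNcDir.mixtureDensity, (hsum x hx).tsum_eq]
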